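/- Conventions. A locally convex algebra is a complete Hausdorff locally convex complex topological vector space with a jointly continuous associative bilinear multiplication (no unit is required); $\mathfrak{LC}$ is the category of locally convex algebras and continuous algebra homomorphisms, and $\mathrm{Ab}$ is the category of abelian groups. A functor $E\colon\mathfrak{LC}\to\mathrm{Ab}$ is $M_2$-stable if for every $L\in\mathfrak{LC}$ the corner inclusion $\iota_L\colon L\to M_2(L)$, $\iota_L(a)=\mathrm{diag}(a,0)$, is sent to an isomorphism $E(\iota_L)$. A unital $C^*$-algebra $\mathcal O$ is properly infinite if there are $s,t\in\mathcal O$ with $s^*s=t^*t=1$ and $s^*t=0$. Let $\mathcal K$ be the $C^*$-algebra of compact operators on $\ell^2(\mathbb Z_{\ge 0})$, with standard matrix units $e_{j,k}$, and let $\widehat\otimes$ be the completed projective tensor product. Corollary 2.5. For every $M_2$-stable functor $E\colon\mathfrak{LC}\to\mathrm{Ab}$ and every properly infinite $C^*$-algebra $\mathcal O$, let $k_{\mathcal O}\colon\mathcal O\to\mathcal O\,\widehat\otimes\,\mathcal K$ be the inclusion $a\mapsto a\,\widehat\otimes\,e_{0,0}$. Then $E(k_{\mathcal O})$ is a naturally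 split monomorphism. That is, there are homomorphisms $$r_{E,\mathcal O}\colon E(\mathcal O\,\widehat\otimes\,\mathcal K)\to E(\mathcal O),$$ one for each such $E$ and $\mathcal O$, such that: 1. $r_{E,\mathcal O}\circ E(k_{\mathcal O})=\mathrm{id}_{E(\mathcal O)}$ for all $E$ and $\mathcal O$; 2. $r_{E,\mathcal O'}\circ E(f\,\widehat\otimes\,\mathrm{id}_{\mathcal K})=E(f)\circ r_{E,\mathcal O}$ for every $E$ and every (not necessarily unital) $*$-homomorphism $f\colon\mathcal O\to\mathcal O'$ of properly infinite $C^*$-algebras; 3. $r_{E',\mathcal O}\circ\tau_{\mathcal O\widehat\otimes\mathcal K}=\tau_{\mathcal O}\circ r_{E,\mathcal O}$ for every $\mathcal O$ and every natural transformation $\tau\colon E\to E'$ of $M_2$-stable functors. -/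

import Mathlib

open CategoryTheory
open scoped TensorProduct

universe u v w

noncomputable section

/-! ## The projective tensor product of Banach algebras -/

section Projective

variable (A : Type u) (B : Type v) [NonUnitalNormedRing A] [NonUnitalNormedRing B]
  [NormedSpace ℂ A] [NormedSpace ℂ B] [IsScalarTower ℂ A A] [SMulCommClass ℂ A A]
  [IsScalarTower ℂ B B] [SMulCommClass ℂ B B]

/-- The algebraic tensor product `A ⊗ B` over `ℂ`, to be normed by the projective norm. -/
def AlgTensor : Type (max u v) := A ⊗[ℂ] B

namespace AlgTensor

instance : NonUnitalRing (AlgTensor A B) := inferInstanceAs (NonUnitalRing (A ⊗[ℂ] B))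

instance : Module ℂ (AlgTensor A B) := inferInstanceAs (Module ℂ (A ⊗[ℂ] B))

variable {A B}

/-- The elementary tensor `a ⊗ b`. -/
def tmul (a : A) (b : B) : AlgTensor A B := a ⊗ₜ[ℂ] b

/-- The element `∑ aᵢ ⊗ bᵢ` represented by a finite list of pairs `(aᵢ, bᵢ)`. -/
def listSum (l : List (A × B)) : AlgTensor A B := (l.map fun p => tmul p.1 p.2).sum

/-- The cost `∑ ‖aᵢ‖ ‖bᵢ‖` of a finite list of pairs `(aᵢ, bᵢ)`. -/
def listCost (l : List (A × B)) : ℝ := (l.map fun p => ‖p.1‖ * ‖p.2‖).sum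

/-- The projective norm: the infimum of `∑ ‖aᵢ‖ ‖bᵢ‖` over all finite representations
`x = ∑ aᵢ ⊗ bᵢ`. -/
def projNorm (x : AlgTensor A B) : ℝ :=
  sInf {r : ℝ | ∃ l : List (A × B), listSum l = x ∧ listCost l = r}

lemma listCost_nonneg (l : List (A × B)) : 0 ≤ listCost l := by
  refine List.sum_nonneg fun r hr => ?_
  obtain ⟨p, -, rfl⟩ := List.mem_map.1 hr
  positivity

lemma exists_listSum (x : AlgTensor A B) : ∃ l : List (A × B), listSum l = x := by
  refine TensorProduct.induction_on (motive := fun x => ∃ l : List (A × B), listSum l = x)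
    x ⟨[], rfl⟩ (fun a b => ⟨[(a, b)], ?_⟩) ?_
  · exact add_zero (tmul a b)
  · rintro _ _ ⟨l, rfl⟩ ⟨m, rfl⟩
    exact ⟨l ++ m, by simp only [listSum, List.map_append, List.sum_append]; rfl⟩

lemma projNorm_nonneg (x : AlgTensor A B) : 0 ≤ projNorm x := by
  refine Real.sInf_nonneg ?_
  rintro _ ⟨l, -, rfl⟩
  exact listCost_nonneg l

lemma projNorm_listSum_le (l : List (A × B)) : projNorm (listSum l) ≤ listCost l := by
  refine csInf_le ⟨0, ?_⟩ ⟨l, rfl, rfl⟩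
  rintro _ ⟨m, -, rfl⟩
  exact listCost_nonneg m

lemma exists_listCost_lt (x : AlgTensor A B) {r : ℝ} (hr : projNorm x < r) :
    ∃ l : List (A × B), listSum l = x ∧ listCost l < r := by
  obtain ⟨m, hm⟩ := exists_listSum x
  obtain ⟨_, ⟨l, hl, rfl⟩, h⟩ := exists_lt_of_csInf_lt (⟨_, m, hm, rfl⟩ :
    {r : ℝ | ∃ l : List (A × B), listSum l = x ∧ listCost l = r}.Nonempty) hr
  exact ⟨l, hl, h⟩

lemma projNorm_add_le (x y : AlgTensor A B) : projNorm (x + y) ≤ projNorm x + projNorm y := by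
  refine le_of_forall_pos_le_add fun ε hε => ?_
  obtain ⟨l, rfl, hl⟩ := exists_listCost_lt x (lt_add_of_pos_right _ (half_pos hε))
  obtain ⟨m, rfl, hm⟩ := exists_listCost_lt y (lt_add_of_pos_right _ (half_pos hε))
  have h := projNorm_listSum_le (l ++ m)
  have h1 : listSum (l ++ m) = listSum l + listSum m := by simp [listSum]
  have h2 : listCost (l ++ m) = listCost l + listCost m := by simp [listCost]
  rw [h1, h2] at h
  linarith

/-- A map of tensor products that multiplies the cost of every list by at most `C` is bounded
by `C` for the projective norm. -/
lemma projNorm_le_of_list {A' : Type*} {B' : Type*} [NonUnitalNormedRing A']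
    [NonUnitalNormedRing B'] [NormedSpace ℂ A'] [NormedSpace ℂ B']
    [IsScalarTower ℂ A' A'] [SMulCommClass ℂ A' A']
    [IsScalarTower ℂ B' B'] [SMulCommClass ℂ B' B']
    (f : AlgTensor A B → AlgTensor A' B') {C : ℝ} (hC : 0 ≤ C)
    (h : ∀ l : List (A × B), ∃ m : List (A' × B'), listSum m = f (listSum l) ∧
      listCost m ≤ C * listCost l) (x : AlgTensor A B) :
    projNorm (f x) ≤ C * projNorm x := by
  refine le_mul_of_forall_lt₀ fun c hc r hr => ?_
  obtain ⟨l, rfl, hl⟩ := exists_listCost_lt x hr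
  obtain ⟨m, hm, hml⟩ := h l
  rw [← hm]
  exact (projNorm_listSum_le m).trans (hml.trans
    (mul_le_mul hc.le hl.le (listCost_nonneg l) (hC.trans hc.le)))

lemma smul_tmul' (c : ℂ) (a : A) (b : B) : c • tmul a b = tmul (c • a) b := rfl

lemma projNorm_smul_le (c : ℂ) (x : AlgTensor A B) : projNorm (c • x) ≤ ‖c‖ * projNorm x := by
  refine projNorm_le_of_list (fun x => c • x) (norm_nonneg c) (fun l =>
    ⟨l.map fun p => (c • p.1, p.2), ?_, ?_⟩) x
  · simp [listSum, List.smul_sum, Function.comp_def, smul_tmul']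
  · simp [listCost, Function.comp_def, norm_smul, mul_assoc, List.sum_map_mul_left]

instance : SeminormedAddCommGroup (AlgTensor A B) :=
  AddGroupSeminorm.toSeminormedAddCommGroup
    { toFun := projNorm
      map_zero' := le_antisymm (by simpa using projNorm_smul_le 0 (0 : AlgTensor A B))
        (projNorm_nonneg _)
      add_le' := projNorm_add_le
      neg' := fun x => by
        have h : ∀ y : AlgTensor A B, projNorm (-y) ≤ projNorm y := fun y => by
          simpa using projNorm_smul_le (-1) y
        exact le_antisymm (h x) (by simpa using h (-x)) }

lemma norm_def (x : AlgTensor A B) : ‖x‖ = projNorm x := rfl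

instance : NormedSpace ℂ (AlgTensor A B) where
  norm_smul_le := projNorm_smul_le

lemma norm_tmul_le (a : A) (b : B) : ‖tmul a b‖ ≤ ‖a‖ * ‖b‖ := by
  have h := projNorm_listSum_le [(a, b)]
  simp only [listSum, listCost, List.map_cons, List.map_nil, List.sum_singleton] at h
  exact h

lemma tmul_mul_tmul (a a' : A) (b b' : B) : tmul a b * tmul a' b' = tmul (a * a') (b * b') :=
  Algebra.TensorProduct.tmul_mul_tmul a a' b b'

instance : IsScalarTower ℂ (AlgTensor A B) (AlgTensor A B) :=
  inferInstanceAs (IsScalarTower ℂ (A ⊗[ℂ] B) (A ⊗[ℂ] B))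

instance : SMulCommClass ℂ (AlgTensor A B) (AlgTensor A B) :=
  inferInstanceAs (SMulCommClass ℂ (A ⊗[ℂ] B) (A ⊗[ℂ] B))

lemma norm_tmul_mul_le (a : A) (b : B) (y : AlgTensor A B) :
    ‖tmul a b * y‖ ≤ (‖a‖ * ‖b‖) * ‖y‖ := by
  refine projNorm_le_of_list (fun y => tmul a b * y) (by positivity) (fun l =>
    ⟨l.map fun p => (a * p.1, b * p.2), ?_, ?_⟩) y
  · simp [listSum, Function.comp_def, ← tmul_mul_tmul, List.sum_map_mul_left]
  · simp only [listCost, List.map_map, Function.comp_def, ← List.sum_map_mul_left]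
    refine List.sum_le_sum fun p _ => ?_
    calc ‖a * p.1‖ * ‖b * p.2‖ ≤ (‖a‖ * ‖p.1‖) * (‖b‖ * ‖p.2‖) := by
          gcongr <;> exact norm_mul_le _ _
      _ = _ := by ring

lemma norm_listSum_mul_le (l : List (A × B)) (y : AlgTensor A B) :
    ‖listSum l * y‖ ≤ listCost l * ‖y‖ := by
  induction l with
  | nil => simp [listSum, listCost]
  | cons p l ih =>
    have h1 : listSum (p :: l) = tmul p.1 p.2 + listSum l := by simp [listSum]
    have h2 : listCost (p :: l) = ‖p.1‖ * ‖p.2‖ + listCost l := by simp [listCost]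
    rw [h1, h2, add_mul, add_mul]
    exact (norm_add_le _ _).trans (add_le_add (norm_tmul_mul_le _ _ _) ih)

instance : NonUnitalSeminormedRing (AlgTensor A B) :=
  { (inferInstance : SeminormedAddCommGroup (AlgTensor A B)),
    (inferInstance : NonUnitalRing (AlgTensor A B)) with
    norm_mul_le := fun x y => by
      refine le_mul_of_forall_lt₀ fun c hc d hd => ?_
      obtain ⟨l, rfl, hl⟩ := exists_listCost_lt x hc
      exact (norm_listSum_mul_le l y).trans
        (mul_le_mul hl.le hd.le (norm_nonneg y) ((listCost_nonneg l).trans hl.le)) }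

lemma induction_on {P : AlgTensor A B → Prop} (x : AlgTensor A B) (h0 : P 0)
    (h1 : ∀ a b, P (tmul a b)) (h2 : ∀ x y, P x → P y → P (x + y)) : P x :=
  TensorProduct.induction_on (motive := P) x h0 h1 h2

section Map

variable {A' : Type*} {B' : Type*} [NonUnitalNormedRing A'] [NonUnitalNormedRing B']
  [NormedSpace ℂ A'] [NormedSpace ℂ B'] [IsScalarTower ℂ A' A'] [SMulCommClass ℂ A' A']
  [IsScalarTower ℂ B' B'] [SMulCommClass ℂ B' B'] (f : A →ₙₐ[ℂ] A') (g : B →ₙₐ[ℂ] B')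

/-- The linear map `f ⊗ g` of algebraic tensor products. -/
def mapLinear : AlgTensor A B →ₗ[ℂ] AlgTensor A' B' :=
  TensorProduct.map (f : A →ₗ[ℂ] A') (g : B →ₗ[ℂ] B')

lemma mapLinear_tmul (a : A) (b : B) : mapLinear f g (tmul a b) = tmul (f a) (g b) := rfl

lemma mapLinear_mul (x y : AlgTensor A B) :
    mapLinear f g (x * y) = mapLinear f g x * mapLinear f g y := by
  induction x using AlgTensor.induction_on with
  | h0 => simp
  | h2 x x' h h' => rw [add_mul, map_add, map_add, add_mul, h, h']
  | h1 a b =>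
    induction y using AlgTensor.induction_on with
    | h0 => simp
    | h2 y y' h h' => rw [mul_add, map_add, map_add, mul_add, h, h']
    | h1 c d => simp only [tmul_mul_tmul, mapLinear_tmul, map_mul]

lemma continuous_mapLinear (hf : Continuous f) (hg : Continuous g) :
    Continuous (mapLinear f g) := by
  let F : A →L[ℂ] A' := ⟨(f : A →ₗ[ℂ] A'), hf⟩
  let G : B →L[ℂ] B' := ⟨(g : B →ₗ[ℂ] B'), hg⟩
  refine AddMonoidHomClass.continuous_of_bound (mapLinear f g) (‖F‖ * ‖G‖) fun x =>
    projNorm_le_of_list (mapLinear f g) (by positivity) (fun l =>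
      ⟨l.map fun p => (f p.1, g p.2), ?_, ?_⟩) x
  · simp [listSum, Function.comp_def, mapLinear_tmul, map_list_sum]
  · simp only [listCost, List.map_map, Function.comp_def, ← List.sum_map_mul_left]
    refine List.sum_le_sum fun p _ => ?_
    calc ‖f p.1‖ * ‖g p.2‖ ≤ (‖F‖ * ‖p.1‖) * (‖G‖ * ‖p.2‖) :=
          mul_le_mul (F.le_opNorm p.1) (G.le_opNorm p.2) (norm_nonneg _) (by positivity)
      _ = _ := by ring

end Map

end AlgTensor

/-- The projective tensor product `A ⊗̂ B` of two Banach algebras: the completion of the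
algebraic tensor product for the projective norm. -/
def ProjTensor : Type (max u v) := UniformSpace.Completion (AlgTensor A B)

namespace ProjTensor

open UniformSpace

instance : NormedAddCommGroup (ProjTensor A B) :=
  inferInstanceAs (NormedAddCommGroup (Completion (AlgTensor A B)))

instance : NormedSpace ℂ (ProjTensor A B) :=
  inferInstanceAs (NormedSpace ℂ (Completion (AlgTensor A B)))

instance : CompleteSpace (ProjTensor A B) :=
  inferInstanceAs (CompleteSpace (Completion (AlgTensor A B)))

variable {A B}

/-- The canonical map `A ⊗ B → A ⊗̂ B`. -/
def incl : AlgTensor A B →L[ℂ] ProjTensor A B :=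
  (Completion.toComplL : AlgTensor A B →L[ℂ] Completion (AlgTensor A B))

lemma isDenseInducing_incl : IsDenseInducing (incl : AlgTensor A B → ProjTensor A B) :=
  Completion.isDenseInducing_coe

lemma incl_zero : (incl (0 : AlgTensor A B) : ProjTensor A B) = 0 := map_zero _

lemma incl_add (x y : AlgTensor A B) : (incl (x + y) : ProjTensor A B) = incl x + incl y :=
  map_add _ x y

lemma incl_smul (c : ℂ) (x : AlgTensor A B) : (incl (c • x) : ProjTensor A B) = c • incl x :=
  map_smul _ c x

lemma norm_incl (x : AlgTensor A B) : ‖incl x‖ = ‖x‖ := Completion.norm_coe x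

/-- The multiplication of `A ⊗̂ B`: the continuous extension of that of `A ⊗ B`. -/
instance : Mul (ProjTensor A B) :=
  ⟨fun x y => (isDenseInducing_incl.prodMap isDenseInducing_incl).extend
    (fun p : AlgTensor A B × AlgTensor A B => (incl (p.1 * p.2) : ProjTensor A B)) (x, y)⟩

lemma incl_mul (x y : AlgTensor A B) : (incl (x * y) : ProjTensor A B) = incl x * incl y :=
  ((isDenseInducing_incl.prodMap isDenseInducing_incl).extend_eq
    (incl.continuous.comp continuous_mul) (x, y)).symm

lemma continuous_mul' : Continuous fun p : ProjTensor A B × ProjTensor A B => p.1 * p.2 := by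
  let m : AlgTensor A B →+ AlgTensor A B →+ ProjTensor A B :=
    (AddMonoidHom.mul : AlgTensor A B →+ AlgTensor A B →+ AlgTensor A B).compr₂
      (incl : AlgTensor A B →L[ℂ] ProjTensor A B).toLinearMap.toAddMonoidHom
  have hm : Continuous fun p : AlgTensor A B × AlgTensor A B => m p.1 p.2 :=
    incl.continuous.comp continuous_mul
  have di : IsDenseInducing
      ((incl : AlgTensor A B →L[ℂ] ProjTensor A B).toLinearMap.toAddMonoidHom) :=
    isDenseInducing_incl
  exact di.extend_Z_bilin di hm

instance : ContinuousMul (ProjTensor A B) := ⟨continuous_mul'⟩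

lemma ext_closed {P : ProjTensor A B → Prop} (hP : IsClosed {x | P x}) (h : ∀ a, P (incl a))
    (x : ProjTensor A B) : P x :=
  isDenseInducing_incl.dense.induction_on x hP h

instance : NonUnitalNormedRing (ProjTensor A B) :=
  { (inferInstance : NormedAddCommGroup (ProjTensor A B)),
    (inferInstance : Mul (ProjTensor A B)) with
    zero_mul := fun x => by
      induction x using ext_closed
      · exact isClosed_eq (continuous_const.mul continuous_id)
          continuous_const
      rename_i a
      rw [← incl_zero, ← incl_mul, zero_mul]
    mul_zero := fun x => by
      induction x using ext_closed
      · exact isClosed_eq (continuous_id.mul continuous_const)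
          continuous_const
      rename_i a
      rw [← incl_zero, ← incl_mul, mul_zero]
    mul_assoc := fun x y z => by
      induction x using ext_closed
      · exact isClosed_eq ((continuous_id.mul continuous_const).mul continuous_const)
          (continuous_id.mul continuous_const)
      rename_i a
      induction y using ext_closed
      · exact isClosed_eq ((continuous_const.mul continuous_id).mul continuous_const)
          (continuous_const.mul (continuous_id.mul continuous_const))
      rename_i b
      induction z using ext_closed
      · exact isClosed_eq (continuous_const.mul continuous_id)
          (continuous_const.mul (continuous_const.mul continuous_id))
      rename_i c
      simp only [← incl_mul, mul_assoc]
    left_distrib := fun x y z => by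
      induction x using ext_closed
      · exact isClosed_eq (continuous_id.mul continuous_const)
          ((continuous_id.mul continuous_const).add (continuous_id.mul continuous_const))
      rename_i a
      induction y using ext_closed
      · exact isClosed_eq (continuous_const.mul (continuous_id.add continuous_const))
          ((continuous_const.mul continuous_id).add continuous_const)
      rename_i b
      induction z using ext_closed
      · exact isClosed_eq (continuous_const.mul (continuous_const.add continuous_id))
          (continuous_const.add (continuous_const.mul continuous_id))
      rename_i c
      rw [← incl_add, ← incl_mul, mul_add, incl_add, incl_mul, incl_mul]
    right_distrib := fun x y z => by
      induction x using ext_closed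
      · exact isClosed_eq ((continuous_id.add continuous_const).mul continuous_const)
          ((continuous_id.mul continuous_const).add continuous_const)
      rename_i a
      induction y using ext_closed
      · exact isClosed_eq ((continuous_const.add continuous_id).mul continuous_const)
          (continuous_const.add (continuous_id.mul continuous_const))
      rename_i b
      induction z using ext_closed
      · exact isClosed_eq (continuous_const.mul continuous_id)
          ((continuous_const.mul continuous_id).add (continuous_const.mul continuous_id))
      rename_i c
      rw [← incl_add, ← incl_mul, add_mul, incl_add, incl_mul, incl_mul]
    norm_mul_le := fun x y => by
      induction x using ext_closed
      · exact isClosed_le (by fun_prop) (by fun_prop)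
      rename_i a
      induction y using ext_closed
      · exact isClosed_le (by fun_prop) (by fun_prop)
      rename_i b
      rw [← incl_mul, norm_incl, norm_incl, norm_incl]
      exact norm_mul_le a b }

instance : IsScalarTower ℂ (ProjTensor A B) (ProjTensor A B) where
  smul_assoc c x y := by
    simp only [smul_eq_mul]
    induction x using ext_closed
    · exact isClosed_eq ((continuous_const_smul c).mul continuous_const)
          ((continuous_id.mul continuous_const).const_smul c)
    rename_i a
    induction y using ext_closed
    · exact isClosed_eq (continuous_const.mul continuous_id)
          ((continuous_const.mul continuous_id).const_smul c)
    rename_i b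
    rw [← incl_smul, ← incl_mul, ← incl_mul, smul_mul_assoc, incl_smul]

instance : SMulCommClass ℂ (ProjTensor A B) (ProjTensor A B) where
  smul_comm c x y := by
    simp only [smul_eq_mul]
    induction x using ext_closed
    · exact isClosed_eq ((continuous_id.mul continuous_const).const_smul c)
          (continuous_id.mul continuous_const)
    rename_i a
    induction y using ext_closed
    · exact isClosed_eq ((continuous_const.mul continuous_id).const_smul c)
          (continuous_const.mul (continuous_const_smul c))
    rename_i b
    rw [← incl_smul, ← incl_mul, ← incl_mul, mul_smul_comm, incl_smul]

/-- The elementary tensor `a ⊗̂ b`. -/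
def tmul (a : A) (b : B) : ProjTensor A B := incl (AlgTensor.tmul a b)

/-- For an idempotent `e`, the homomorphism `A → A ⊗̂ B`, `a ↦ a ⊗̂ e`. -/
def inclLeft (e : B) (he : e * e = e) : A →ₙₐ[ℂ] ProjTensor A B where
  toFun a := tmul a e
  map_smul' c a := by
    rw [tmul, MonoidHom.id_apply, tmul, ← incl_smul, AlgTensor.smul_tmul']
  map_zero' := by rw [tmul, ← incl_zero]; exact congrArg _ (TensorProduct.zero_tmul A e)
  map_add' a a' := by
    rw [tmul, tmul, tmul, ← incl_add]; exact congrArg _ (TensorProduct.add_tmul a a' e)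
  map_mul' a a' := by
    rw [tmul, tmul, tmul, ← incl_mul, AlgTensor.tmul_mul_tmul, he]

lemma continuous_inclLeft (e : B) (he : e * e = e) :
    Continuous (inclLeft e he : A →ₙₐ[ℂ] ProjTensor A B) := by
  refine AddMonoidHomClass.continuous_of_bound (inclLeft e he) ‖e‖ fun a => ?_
  rw [mul_comm]
  exact (norm_incl _).trans_le (AlgTensor.norm_tmul_le a e)

section Map

variable {A' : Type*} {B' : Type*} [NonUnitalNormedRing A'] [NonUnitalNormedRing B']
  [NormedSpace ℂ A'] [NormedSpace ℂ B'] [IsScalarTower ℂ A' A'] [SMulCommClass ℂ A' A']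
  [IsScalarTower ℂ B' B'] [SMulCommClass ℂ B' B'] (f : A →ₙₐ[ℂ] A') (g : B →ₙₐ[ℂ] B')

/-- The underlying function of `f ⊗̂ g`: the continuous extension of `f ⊗ g`. -/
def mapFun (f : A →ₙₐ[ℂ] A') (g : B →ₙₐ[ℂ] B') : ProjTensor A B → ProjTensor A' B' :=
  Completion.map (AlgTensor.mapLinear f g)

lemma continuous_mapFun : Continuous (mapFun f g) := Completion.continuous_map

lemma mapFun_incl (hf : Continuous f) (hg : Continuous g) (x : AlgTensor A B) : mapFun f g (incl x) = incl (AlgTensor.mapLinear f g x) :=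
  Completion.map_coe (uniformContinuous_addMonoidHom_of_continuous
    (f := (AlgTensor.mapLinear f g).toAddMonoidHom)
    (AlgTensor.continuous_mapLinear f g hf hg)) x

/-- The homomorphism `f ⊗̂ g : A ⊗̂ B → A' ⊗̂ B'` induced by continuous homomorphisms
`f` and `g`, characterized by `a ⊗̂ b ↦ f a ⊗̂ g b` and continuity. -/
def map (hf : Continuous f) (hg : Continuous g) : ProjTensor A B →ₙₐ[ℂ] ProjTensor A' B' where
  toFun := mapFun f g
  map_smul' c x := by
    have hc := continuous_mapFun f g
    induction x using ext_closed
    · exact isClosed_eq (hc.comp (continuous_const_smul c)) (hc.const_smul c)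
    rename_i a
    rw [MonoidHom.id_apply, ← incl_smul, mapFun_incl f g hf hg, mapFun_incl f g hf hg, map_smul,
      incl_smul]
  map_zero' := by rw [← incl_zero, mapFun_incl f g hf hg, map_zero, incl_zero]
  map_add' x y := by
    have hc := continuous_mapFun f g
    induction x using ext_closed
    · exact isClosed_eq (hc.comp (continuous_id.add continuous_const)) (hc.add continuous_const)
    rename_i a
    induction y using ext_closed
    · exact isClosed_eq (hc.comp (continuous_const.add continuous_id)) (continuous_const.add hc)
    rename_i b
    rw [← incl_add, mapFun_incl f g hf hg, mapFun_incl f g hf hg, mapFun_incl f g hf hg, map_add,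
      incl_add]
  map_mul' x y := by
    have hc := continuous_mapFun f g
    induction x using ext_closed
    · exact isClosed_eq (hc.comp (continuous_id.mul continuous_const)) (hc.mul continuous_const)
    rename_i a
    induction y using ext_closed
    · exact isClosed_eq (hc.comp (continuous_const.mul continuous_id)) (continuous_const.mul hc)
    rename_i b
    simp only [← incl_mul, mapFun_incl f g hf hg, AlgTensor.mapLinear_mul]

lemma map_tmul (hf : Continuous f) (hg : Continuous g) (a : A) (b : B) : map f g hf hg (tmul a b) = tmul (f a) (g b) :=
  mapFun_incl f g hf hg _

end Map

end ProjTensor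

end Projective

/-! ## The category of complete locally convex algebras -/

/-- A complete locally convex algebra: a complete Hausdorff locally convex complex vector space
(its topology is defined by seminorms) with a jointly continuous associative bilinear
multiplication; no unit is required. -/
structure LCAlg where
  /-- The underlying type. -/
  carrier : Type u
  [ring : NonUnitalRing carrier]
  [module : Module ℂ carrier]
  [scalarTower : IsScalarTower ℂ carrier carrier]
  [smulComm : SMulCommClass ℂ carrier carrier]
  [uniformSpace : UniformSpace carrier]
  [uniformAddGroup : IsUniformAddGroup carrier]
  [continuousSMul : ContinuousSMul ℂ carrier]
  [continuousMul : ContinuousMul carrier]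
  [locallyConvex : PolynormableSpace ℂ carrier]
  [complete : CompleteSpace carrier]
  [hausdorff : T2Space carrier]

namespace LCAlg

instance : CoeSort LCAlg.{u} (Type u) := ⟨carrier⟩

attribute [instance] ring module scalarTower smulComm uniformSpace uniformAddGroup continuousSMul
  continuousMul locallyConvex complete hausdorff

/-- Morphisms of locally convex algebras: continuous (not necessarily unital) algebra
homomorphisms. -/
@[ext]
structure Hom (L M : LCAlg.{u}) where
  /-- The underlying algebra homomorphism. -/
  toAlgHom : L →ₙₐ[ℂ] M
  continuous_toAlgHom : Continuous toAlgHom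

instance : Category LCAlg.{u} where
  Hom := Hom
  id L := ⟨NonUnitalAlgHom.id ℂ L, continuous_id⟩
  comp f g := ⟨g.toAlgHom.comp f.toAlgHom, g.continuous_toAlgHom.comp f.continuous_toAlgHom⟩

instance (L : LCAlg.{u}) : IsTopologicalRing L where
  continuous_neg := continuous_neg

/-- A Banach algebra, as a locally convex algebra. -/
abbrev of (A : Type u) [NonUnitalNormedRing A] [NormedSpace ℂ A] [IsScalarTower ℂ A A]
    [SMulCommClass ℂ A A] [CompleteSpace A] : LCAlg.{u} where
  carrier := A

/-- The algebra `M₂(L)` with the topology of entrywise convergence. -/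
def matrixTwo (L : LCAlg.{u}) : LCAlg.{u} :=
  have : PolynormableSpace ℂ (Matrix (Fin 2) (Fin 2) L) :=
    inferInstanceAs (PolynormableSpace ℂ (Fin 2 → Fin 2 → L))
  { carrier := Matrix (Fin 2) (Fin 2) L }

/-- The upper left corner inclusion `ι : L → M₂(L)`, `a ↦ diag(a, 0)`. -/
def corner (L : LCAlg.{u}) : L ⟶ matrixTwo L :=
  let F : L →ₙₐ[ℂ] Matrix (Fin 2) (Fin 2) L :=
    { toFun := fun a => !![a, 0; 0, 0]
      map_smul' := fun c a => by ext i j; fin_cases i <;> fin_cases j <;> simp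
      map_zero' := by ext i j; fin_cases i <;> fin_cases j <;> simp
      map_add' := fun a b => by ext i j; fin_cases i <;> fin_cases j <;> simp
      map_mul' := fun a b => by ext i j; fin_cases i <;> fin_cases j <;> simp }
  have hF : Continuous F := continuous_matrix fun i j => by
    fin_cases i <;> fin_cases j
    · exact continuous_id
    all_goals exact continuous_const
  ⟨F, hF⟩

/-- A functor from locally convex algebras to abelian groups is `M₂`-stable if it sends every
corner inclusion `ι : L → M₂(L)` to an isomorphism. -/
def IsM2Stable (E : LCAlg.{u} ⥤ AddCommGrpCat.{w}) : Prop :=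
  ∀ L : LCAlg.{u}, IsIso (E.map (corner L))

end LCAlg

/-! ## The compact operators and properly infinite C⋆-algebras -/

/-- The Hilbert space `ℓ²(ℤ_{≥ 0})`. -/
abbrev EllTwo : Type := lp (fun _ : ℕ => ℂ) 2

/-- The C⋆-algebra `𝒦` of compact operators on `ℓ²(ℤ_{≥ 0})`, with the operator norm. -/
def compactOps : NonUnitalSubalgebra ℂ (EllTwo →L[ℂ] EllTwo) where
  carrier := {T | IsCompactOperator T}
  add_mem' hS hT := hS.add hT
  zero_mem' := isCompactOperator_zero
  mul_mem' {_ T} hS _ := hS.comp_clm T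
  smul_mem' c _ hT := hT.smul c

instance : NormedSpace ℂ compactOps where
  norm_smul_le c x := norm_smul_le c x.1

/-- The `j`-th standard basis vector of `ℓ²(ℤ_{≥ 0})`. -/
def basisVec (j : ℕ) : EllTwo := lp.single 2 j (1 : ℂ)

/-- The standard matrix unit `e_{j,k}` of `𝒦`: the operator `x ↦ ⟪δ_k, x⟫ δ_j`. -/
def matrixUnit (j k : ℕ) : compactOps :=
  ⟨InnerProductSpace.rankOne ℂ (basisVec j) (basisVec k), by
    have h : IsCompactOperator (innerSL ℂ (basisVec k) : EllTwo → ℂ) :=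
      isCompactOperator_of_locallyCompactSpace_dom (innerSL ℂ (basisVec k))
    exact h.clm_comp (ContinuousLinearMap.toSpanSingleton ℂ (basisVec j))⟩

lemma matrixUnit_zero_mul_self : matrixUnit 0 0 * matrixUnit 0 0 = matrixUnit 0 0 := by
  refine Subtype.ext (ContinuousLinearMap.ext fun x => ?_)
  simp [matrixUnit, basisVec]

/-- A (unital) C⋆-algebra is properly infinite if it contains two isometries with orthogonal
ranges. -/
def IsProperlyInfinite (O : Type u) [CStarAlgebra O] : Prop :=
  ∃ s t : O, star s * s = 1 ∧ star t * t = 1 ∧ star s * t = 0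

namespace ProperlyInfinite

variable (O : Type u) [CStarAlgebra O]

/-- The C⋆-algebra `O`, as a locally convex algebra. -/
abbrev obj : LCAlg.{u} := LCAlg.of O

/-- The locally convex algebra `O ⊗̂ 𝒦`. -/
abbrev stab : LCAlg.{u} := LCAlg.of (ProjTensor O compactOps)

/-- The inclusion `k : O → O ⊗̂ 𝒦`, `a ↦ a ⊗̂ e_{0,0}`. -/
def inclK : obj O ⟶ stab O where
  toAlgHom := ProjTensor.inclLeft (matrixUnit 0 0) matrixUnit_zero_mul_self
  continuous_toAlgHom := ProjTensor.continuous_inclLeft _ _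

/-- The homomorphism `O → O'` of locally convex algebras given by a `*`-homomorphism. -/
def objMap {O O' : Type u} [CStarAlgebra O] [CStarAlgebra O'] (f : O →⋆ₙₐ[ℂ] O') :
    obj O ⟶ obj O' where
  toAlgHom := f.toNonUnitalAlgHom
  continuous_toAlgHom :=
    (NonUnitalStarAlgHom.instContinuousLinearMapClassComplex (F := O →⋆ₙₐ[ℂ] O')).map_continuous f

/-- The homomorphism `f ⊗̂ id : O ⊗̂ 𝒦 → O' ⊗̂ 𝒦` given by a `*`-homomorphism `f : O → O'`. -/
def stabMap {O O' : Type u} [CStarAlgebra O] [CStarAlgebra O'] (f : O →⋆ₙₐ[ℂ] O') :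
    stab O ⟶ stab O' where
  toAlgHom := ProjTensor.map f.toNonUnitalAlgHom (NonUnitalAlgHom.id ℂ compactOps)
    (objMap f).continuous_toAlgHom continuous_id
  continuous_toAlgHom := ProjTensor.continuous_mapFun _ _

end ProperlyInfinite

end

noncomputable section

/-! ### Corner inclusions and the consequences of M₂-stability. -/

namespace LCAlg

/-! Isometries x₀, x₁, … in `O` with orthogonal ranges absorb the compact operators: a ⊗ T ↦ ∑ Tᵢⱼ
xᵢ a xⱼ* is a continuous homomorphism `O ⊗̂ 𝒦 → O`, and the retraction `r` is its image under `E`.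
Preceded by the inclusion `k`, it becomes a ↦ x₀ a x₀*.

M₂-stability enters through one principle, `IsM2Stable.map_eq_of_entrywise`: the two diagonal
entries of a homomorphism M₂(A) → M₂(B) acting entrywise have the same image under `E`. Applied to
conjugation by an isometry and to the identity, it shows that `r` splits `E(k)`. Applied to the maps
built from two families (xᵢ) and (yᵢ), it shows that the choice of family is invisible to `E`.
Naturality in `O` follows: for f : O → O', the two composites `O ⊗̂ 𝒦 → O'` are the maps built from
f(xᵢ) and from yᵢ f(1). Since f need not be unital, these are only partial isometries with source
f(1), which is why `IsFrame` is relative to f. Naturality in `E` is automatic, because the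
underlying homomorphism does not involve `E`.

The analytic point is continuity on the projective tensor product. `IsFrame.norm_frameSum_le` bounds
the finite sums by ‖a‖‖T‖, uniformly in their size, and `tendsto_trunc` (finite matrices are dense
in `𝒦`) passes to the limit and reduces identities to the elements a ⊗ eᵢⱼ. -/

@[simp] lemma comp_apply {L M N : LCAlg.{u}} (f : L ⟶ M) (g : M ⟶ N) (x : L) :
    (f ≫ g).toAlgHom x = g.toAlgHom (f.toAlgHom x) := rfl

lemma hom_ext {L M : LCAlg.{u}} {f g : L ⟶ M} (h : ∀ x, f.toAlgHom x = g.toAlgHom x) : f = g :=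
  Hom.ext (NonUnitalAlgHom.ext h)

/-- The inclusion `L → M₂(L)` at the `i`-th diagonal position. -/
def cornerAt (L : LCAlg.{u}) (i : Fin 2) : L ⟶ matrixTwo L :=
  let F : L →ₙₐ[ℂ] Matrix (Fin 2) (Fin 2) L :=
    { toFun := fun a => Matrix.single i i a
      map_smul' := fun c a => (Matrix.smul_single c i i a).symm
      map_zero' := Matrix.single_zero i i
      map_add' := fun a b => Matrix.single_add i i a b
      map_mul' := fun a b => (Matrix.single_mul_single_same (α := L) a i i i b).symm }
  have hF : Continuous F := continuous_matrix fun j k => by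
    change Continuous fun a => Matrix.single i i a j k
    simp only [Matrix.single_apply]
    split_ifs <;> fun_prop
  ⟨F, hF⟩

lemma cornerAt_apply (L : LCAlg.{u}) (i : Fin 2) (a : L) :
    (cornerAt L i).toAlgHom a = (Matrix.single i i a : Matrix (Fin 2) (Fin 2) L) := rfl

lemma cornerAt_zero (L : LCAlg.{u}) : cornerAt L 0 = corner L := by
  refine hom_ext fun a => ?_
  change (Matrix.single 0 0 a : Matrix (Fin 2) (Fin 2) L) = !![a, 0; 0, 0]
  ext i j
  fin_cases i <;> fin_cases j <;> simp

/-- The endomorphism of `M₂(L)` permuting rows and columns. -/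
def permMap (L : LCAlg.{u}) (σ : Equiv.Perm (Fin 2)) : matrixTwo L ⟶ matrixTwo L :=
  let F : Matrix (Fin 2) (Fin 2) L →ₙₐ[ℂ] Matrix (Fin 2) (Fin 2) L :=
    { toFun := fun a => a.submatrix σ σ
      map_smul' := fun _ _ => rfl
      map_zero' := rfl
      map_add' := fun _ _ => rfl
      map_mul' := fun a b => (Matrix.submatrix_mul_equiv a b σ σ σ).symm }
  have hF : Continuous F := continuous_id.matrix_submatrix σ σ
  ⟨F, hF⟩

/-- The endomorphism of `M₂(M₂(R)) = M₄(R)` permuting rows and columns. -/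
def blockPerm (R : Type*) [NonUnitalRing R] [Module ℂ R] (σ : Equiv.Perm (Fin 2 × Fin 2)) :
    Matrix (Fin 2) (Fin 2) (Matrix (Fin 2) (Fin 2) R) →ₙₐ[ℂ]
      Matrix (Fin 2) (Fin 2) (Matrix (Fin 2) (Fin 2) R) where
  toFun a := Matrix.of fun p q => Matrix.of fun i j =>
    a (σ (p, i)).1 (σ (q, j)).1 (σ (p, i)).2 (σ (q, j)).2
  map_smul' _ _ := rfl
  map_zero' := rfl
  map_add' _ _ := rfl
  map_mul' a b := by
    ext p q i j
    simp only [Matrix.mul_apply, Matrix.sum_apply, Matrix.of_apply]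
    rw [← Fintype.sum_prod_type', ← Fintype.sum_prod_type']
    exact (Equiv.sum_comp σ fun x => a (σ (p, i)).1 x.1 (σ (p, i)).2 x.2 *
      b x.1 (σ (q, j)).1 x.2 (σ (q, j)).2).symm

/-- Entries are pulled back along σ, so the one at σ (p, i) lands at (p, i). In each pair the block
index comes first and the index inside the block second. -/
lemma blockPerm_single_single (R : Type*) [NonUnitalRing R] [Module ℂ R]
    (σ : Equiv.Perm (Fin 2 × Fin 2)) {i p j q : Fin 2} (h : σ (p, i) = (q, j)) (a : R) :
    blockPerm R σ (Matrix.single q q (Matrix.single j j a)) =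
      Matrix.single p p (Matrix.single i i a) := by
  have key : ∀ x : Fin 2 × Fin 2, (q = (σ x).1 ∧ j = (σ x).2) ↔ (p = x.1 ∧ i = x.2) := fun x => by
    rw [← Prod.ext_iff (x := (q, j)), ← Prod.ext_iff (x := (p, i)), ← h, σ.apply_eq_iff_eq]
  have entry : ∀ (q j r s r' s' : Fin 2), (Matrix.single q q (Matrix.single j j a) :
      Matrix (Fin 2) (Fin 2) (Matrix (Fin 2) (Fin 2) R)) r s r' s' =
        if (q = r ∧ j = r') ∧ (q = s ∧ j = s') then a else 0 := fun q j r s r' s' => by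
    by_cases h : q = r ∧ q = s
    · rw [Matrix.single_apply, if_pos h]
      simp [Matrix.single_apply, h.1, ← h.2]
    · rw [Matrix.single_apply, if_neg h, if_neg fun h' => h ⟨h'.1.1, h'.2.1⟩]
      rfl
  ext r s r' s'
  refine (entry _ _ _ _ _ _).trans (Eq.trans ?_ (entry p i r s r' s').symm)
  exact if_congr (and_congr (key (r, r')) (key (s, s'))) rfl rfl

/-- The endomorphism `blockPerm` as a morphism of locally convex algebras. -/
def blockPermMap (L : LCAlg.{u}) (σ : Equiv.Perm (Fin 2 × Fin 2)) :
    matrixTwo (matrixTwo L) ⟶ matrixTwo (matrixTwo L) :=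
  have hF : Continuous (blockPerm L σ) := continuous_matrix fun _ _ => continuous_matrix fun _ _ =>
    (continuous_id.matrix_elem _ _).matrix_elem _ _
  ⟨blockPerm L σ, hF⟩

lemma cornerAt_comp_permMap (L : LCAlg.{u}) (σ : Equiv.Perm (Fin 2)) (i : Fin 2) :
    cornerAt L (σ i) ≫ permMap L σ = cornerAt L i := by
  refine hom_ext fun a => ?_
  change (Matrix.single (σ i) (σ i) a : Matrix (Fin 2) (Fin 2) L).submatrix σ σ = Matrix.single i i a
  ext j k
  simp [Matrix.single_apply]

lemma cornerAt_comp_blockPermMap (L : LCAlg.{u}) (σ : Equiv.Perm (Fin 2 × Fin 2))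
    {i p j q : Fin 2} (h : σ (p, i) = (q, j)) :
    (cornerAt L j ≫ cornerAt (matrixTwo L) q) ≫ blockPermMap L σ =
      cornerAt L i ≫ cornerAt (matrixTwo L) p := by
  exact hom_ext fun a => blockPerm_single_single L σ h a

lemma permMap_comp_permMap_symm (L : LCAlg.{u}) (σ : Equiv.Perm (Fin 2)) :
    permMap L σ ≫ permMap L σ.symm = 𝟙 _ := by
  refine hom_ext fun a => ?_
  change ((a : Matrix (Fin 2) (Fin 2) L).submatrix σ σ).submatrix σ.symm σ.symm = a
  exact (Matrix.submatrix_submatrix ..).trans (by rw [Equiv.self_comp_symm]; rfl)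

instance (L : LCAlg.{u}) (σ : Equiv.Perm (Fin 2)) : IsIso (permMap L σ) :=
  ⟨permMap L σ.symm, permMap_comp_permMap_symm L σ, permMap_comp_permMap_symm L σ.symm⟩

variable {E : LCAlg.{u} ⥤ AddCommGrpCat.{w}}

/-- Exchanging 0 and i is an automorphism of M₂(L) that carries the standard corner to the i-th one.
-/
lemma IsM2Stable.isIso_map_cornerAt (hE : IsM2Stable E) (L : LCAlg.{u}) (i : Fin 2) :
    IsIso (E.map (cornerAt L i)) := by
  have := hE L
  have h := cornerAt_comp_permMap L (Equiv.swap 0 i) i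
  rw [Equiv.swap_apply_right, cornerAt_zero] at h
  rw [← h, E.map_comp]
  infer_instance

/-- An `M₂`-stable functor does not distinguish the two corner inclusions. -/
lemma IsM2Stable.map_cornerAt_eq (hE : IsM2Stable E) (L : LCAlg.{u}) :
    E.map (cornerAt L 0) = E.map (cornerAt L 1) := by
  have := hE.isIso_map_cornerAt L 0
  have := hE.isIso_map_cornerAt (matrixTwo L) 0
  have := hE.isIso_map_cornerAt (matrixTwo L) 1
  -- The swap of M₂(L) fixes neither corner, so nothing is known yet about its image under `E`. In
  -- M₄(L) this transposition fixes the (0, 0) corner, which `E` inverts; hence `E` sends it to the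
  -- identity, although it exchanges two other corners.
  let σ : Equiv.Perm (Fin 2 × Fin 2) := Equiv.swap (1, 0) (1, 1)
  have h0 := congrArg E.map (cornerAt_comp_blockPermMap L σ (i := 0) (p := 0) (j := 0) (q := 0)
    (Equiv.swap_apply_of_ne_of_ne (by decide) (by decide)))
  have h1 := congrArg E.map (cornerAt_comp_blockPermMap L σ (i := 1) (p := 1) (j := 0) (q := 1)
    (Equiv.swap_apply_right _ _))
  have hσ : E.map (blockPermMap L σ) = 𝟙 _ := by
    rw [E.map_comp] at h0
    have : IsIso (E.map (cornerAt L 0 ≫ cornerAt (matrixTwo L) 0)) := by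
      rw [E.map_comp]; infer_instance
    rw [← cancel_epi (E.map (cornerAt L 0 ≫ cornerAt (matrixTwo L) 0)), h0, Category.comp_id]
  rw [E.map_comp, hσ, Category.comp_id, E.map_comp, E.map_comp, cancel_mono] at h1
  exact h1

/-- Two homomorphisms `φ₀, φ₁ : A → B` that are the diagonal of a homomorphism
`M₂(A) → M₂(B)` acting entrywise induce the same map under an `M₂`-stable functor. -/
lemma IsM2Stable.map_eq_of_entrywise (hE : IsM2Stable E) {A B : LCAlg.{u}} (φ : Fin 2 → (A ⟶ B))
    (g : Fin 2 → Fin 2 → A →L[ℂ] B) (hg : ∀ p q r x y, g p q x * g q r y = g p r (x * y))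
    (hφ : ∀ p x, (φ p).toAlgHom x = g p p x) : E.map (φ 0) = E.map (φ 1) := by
  let F : Matrix (Fin 2) (Fin 2) A →ₙₐ[ℂ] Matrix (Fin 2) (Fin 2) B :=
    { toFun := fun a => Matrix.of fun p q => g p q (a p q)
      map_smul' := fun c a => by ext p q; exact map_smul (g p q) c (a p q)
      map_zero' := by ext p q; exact map_zero (g p q)
      map_add' := fun a b => by ext p q; exact map_add (g p q) (a p q) (b p q)
      map_mul' := fun a b => by
        ext p q
        simp only [Matrix.mul_apply, Matrix.of_apply, map_sum, hg] }
  have hF : Continuous F := continuous_matrix fun p q =>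
    (g p q).continuous.comp (continuous_id.matrix_elem p q)
  let Φ : matrixTwo A ⟶ matrixTwo B := ⟨F, hF⟩
  -- Φ intertwines the p-th corners through φ p. Since `E` identifies the two corners of A, and
  -- those of B, and inverts the latter, it identifies φ 0 with φ 1.
  have h : ∀ p, cornerAt A p ≫ Φ = φ p ≫ cornerAt B p := fun p => hom_ext fun x => by
    rw [comp_apply, comp_apply, cornerAt_apply, cornerAt_apply, hφ]
    change F (Matrix.single p p x) = _
    ext i j
    change g i j (Matrix.single p p x i j) = Matrix.single p p (g p p x) i j
    by_cases hp : p = i ∧ p = j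
    · obtain ⟨rfl, rfl⟩ := hp
      simp
    · simp [hp]
  have := hE.isIso_map_cornerAt B 1
  have h0 := congrArg E.map (h 0)
  have h1 := congrArg E.map (h 1)
  rw [E.map_comp, E.map_comp] at h0 h1
  rw [hE.map_cornerAt_eq A, h1, hE.map_cornerAt_eq B, cancel_mono] at h0
  exact h0.symm

end LCAlg

/-! ### Extending contractive bilinear maps to the projective tensor product. -/

section Lift

variable {A : Type u} {B : Type v} [NonUnitalNormedRing A] [NonUnitalNormedRing B]
  [NormedSpace ℂ A] [NormedSpace ℂ B] [IsScalarTower ℂ A A] [SMulCommClass ℂ A A]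
  [IsScalarTower ℂ B B] [SMulCommClass ℂ B B]
  {C : Type*} [NormedAddCommGroup C] [NormedSpace ℂ C]

namespace AlgTensor

/-- The linear map on `A ⊗ B` induced by a bilinear map. -/
def liftLinear (β : A →ₗ[ℂ] B →ₗ[ℂ] C) : AlgTensor A B →ₗ[ℂ] C :=
  TensorProduct.lift β

/-- The bound holds for every representation of a tensor, so the infimum over representations makes
the lift contractive. -/
lemma norm_liftLinear_listSum_le {β : A →ₗ[ℂ] B →ₗ[ℂ] C}
    (hβ : ∀ a b, ‖β a b‖ ≤ ‖a‖ * ‖b‖) (l : List (A × B)) :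
    ‖liftLinear β (listSum l)‖ ≤ listCost l := by
  induction l with
  | nil => simp [listSum, listCost]
  | cons p l ih =>
    have h1 : listSum (p :: l) = tmul p.1 p.2 + listSum l := by simp [listSum]
    have h2 : listCost (p :: l) = ‖p.1‖ * ‖p.2‖ + listCost l := by simp [listCost]
    rw [h1, h2, map_add]
    exact (norm_add_le _ _).trans (add_le_add (hβ _ _) ih)

/-- The continuous linear map on `A ⊗ B` induced by a contractive bilinear map. -/
def lift (β : A →ₗ[ℂ] B →ₗ[ℂ] C) (hβ : ∀ a b, ‖β a b‖ ≤ ‖a‖ * ‖b‖) : AlgTensor A B →L[ℂ] C :=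
  (liftLinear β).mkContinuous 1 fun x => by
    rw [one_mul]
    refine le_of_forall_gt fun r hr => ?_
    obtain ⟨l, rfl, hl⟩ := exists_listCost_lt x hr
    exact (norm_liftLinear_listSum_le hβ l).trans_lt hl

end AlgTensor

namespace ProjTensor

lemma tmul_mul_tmul (a a' : A) (b b' : B) :
    (tmul a b * tmul a' b' : ProjTensor A B) = tmul (a * a') (b * b') := by
  rw [tmul, tmul, tmul, ← incl_mul, AlgTensor.tmul_mul_tmul]

/-- The map `b ↦ a ⊗̂ b`. -/
def tmulRight (a : A) : B →L[ℂ] ProjTensor A B :=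
  incl.comp (((TensorProduct.mk ℂ A B a : B →ₗ[ℂ] A ⊗[ℂ] B) : B →ₗ[ℂ] AlgTensor A B).mkContinuous
    ‖a‖ fun b => AlgTensor.norm_tmul_le a b)

lemma tmulRight_apply (a : A) (b : B) : tmulRight a b = tmul a b := rfl

lemma smul_tmul (c : ℂ) (a : A) (b : B) : c • (tmul a b : ProjTensor A B) = tmul (c • a) b := by
  rw [tmul, tmul, ← incl_smul, AlgTensor.smul_tmul']

lemma zero_tmul (b : B) : (tmul 0 b : ProjTensor A B) = 0 := by
  rw [← zero_smul ℂ (0 : A), ← smul_tmul, zero_smul]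

lemma tmul_zero (a : A) : (tmul a 0 : ProjTensor A B) = 0 :=
  map_zero (tmulRight a : B →L[ℂ] ProjTensor A B)

variable [CompleteSpace C]

/-- The continuous linear map on `A ⊗̂ B` induced by a contractive bilinear map. -/
def lift (β : A →ₗ[ℂ] B →ₗ[ℂ] C) (hβ : ∀ a b, ‖β a b‖ ≤ ‖a‖ * ‖b‖) : ProjTensor A B →L[ℂ] C :=
  (AlgTensor.lift β hβ).extend incl

lemma lift_tmul (β : A →ₗ[ℂ] B →ₗ[ℂ] C) (hβ : ∀ a b, ‖β a b‖ ≤ ‖a‖ * ‖b‖) (a : A) (b : B) :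
    lift β hβ (tmul a b) = β a b :=
  (AlgTensor.lift β hβ).extend_eq isDenseInducing_incl.dense
    (AddMonoidHomClass.isometry_of_norm (incl : AlgTensor A B →L[ℂ] ProjTensor A B)
      norm_incl).isUniformInducing _

end ProjTensor

end Lift

/-! ## Compact operators are limits of finite matrices -/

section Compact

open Filter Topology InnerProductSpace

/-- Strong convergence of contractions is uniform on compact sets, here on the closure of the image
of the unit ball under `T`. -/
lemma IsCompactOperator.tendsto_comp {F G : Type*} [NormedAddCommGroup F] [NormedSpace ℂ F]
    [NormedAddCommGroup G] [NormedSpace ℂ G] {T : F →L[ℂ] G} (hT : IsCompactOperator T)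
    {P : ℕ → G →L[ℂ] G} (hP : ∀ n, ‖P n‖ ≤ 1) (hlim : ∀ x, Tendsto (fun n => P n x) atTop (𝓝 x)) :
    Tendsto (fun n => (P n).comp T) atTop (𝓝 T) := by
  rw [Metric.tendsto_atTop]
  intro ε hε
  have hK := (hT.isCompact_closure_image_closedBall 1).totallyBounded
  -- Three errors of ε / 4 occur below; the fourth quarter restores the strict inequality lost in
  -- passing to the operator norm.
  obtain ⟨t, ht, htK⟩ := Metric.totallyBounded_iff.1 hK (ε / 4) (by positivity)
  have hev : ∀ᶠ n in atTop, ∀ y ∈ t, dist (P n y) y < ε / 4 :=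
    (ht.eventually_all).2 fun y _ => Metric.tendsto_nhds.1 (hlim y) _ (by positivity)
  obtain ⟨N, hN⟩ := eventually_atTop.1 hev
  refine ⟨N, fun n hn => ?_⟩
  rw [dist_eq_norm]
  refine lt_of_le_of_lt (ContinuousLinearMap.opNorm_le_of_unit_norm (C := 3 * (ε / 4))
    (by positivity) fun x hx => ?_) (by linarith)
  have hx' : T x ∈ closure (T '' Metric.closedBall 0 1) :=
    subset_closure ⟨x, by simp [hx], rfl⟩
  obtain ⟨y, hy, hxy⟩ := Set.mem_iUnion₂.1 (htK hx')
  have hxy' : ‖T x - y‖ < ε / 4 := by rwa [← dist_eq_norm]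
  have h1 : ‖P n (T x - y)‖ ≤ 1 * ‖T x - y‖ := (P n).le_of_opNorm_le (hP n) _
  have h2 : ‖P n y - y‖ < ε / 4 := by rw [← dist_eq_norm]; exact hN n hn y hy
  have h3 : ((P n).comp T - T) x = P n (T x - y) + (P n y - y) - (T x - y) := by
    simp
  rw [h3]
  have := norm_sub_le (P n (T x - y) + (P n y - y)) (T x - y)
  have := norm_add_le (P n (T x - y)) (P n y - y)
  linarith

lemma Orthonormal.norm_sq_sum {ι F : Type*} [NormedAddCommGroup F] [InnerProductSpace ℂ F]
    {e : ι → F} (he : Orthonormal ℂ e) (c : ι → ℂ) (s : Finset ι) :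
    ‖∑ i ∈ s, c i • e i‖ ^ 2 = ∑ i ∈ s, ‖c i‖ ^ 2 := by
  rw [@norm_sq_eq_re_inner ℂ, he.inner_sum, map_sum]
  refine Finset.sum_congr rfl fun i _ => ?_
  rw [RCLike.conj_mul, ← RCLike.ofReal_pow, RCLike.ofReal_re]

lemma orthonormal_basisVec : Orthonormal ℂ basisVec := by
  rw [orthonormal_iff_ite]
  intro i j
  simp [basisVec, lp.inner_single_left, Pi.single_apply]

lemma inner_basisVec (i : ℕ) (x : EllTwo) : ⟪basisVec i, x⟫_ℂ = x i := by
  simp [basisVec, lp.inner_single_left]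

/-- The orthogonal projection onto the span of the first `n` basis vectors. -/
def truncProj (n : ℕ) : EllTwo →L[ℂ] EllTwo :=
  ∑ i ∈ Finset.range n, rankOne ℂ (basisVec i) (basisVec i)

lemma truncProj_apply (n : ℕ) (x : EllTwo) :
    truncProj n x = ∑ i ∈ Finset.range n, ⟪basisVec i, x⟫_ℂ • basisVec i := by
  simp [truncProj]

lemma tendsto_truncProj (x : EllTwo) : Tendsto (fun n => truncProj n x) atTop (𝓝 x) := by
  have h := (lp.hasSum_single (p := 2) (by simp) x).tendsto_sum_nat
  refine h.congr fun n => ?_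
  rw [truncProj_apply]
  refine Finset.sum_congr rfl fun i _ => ?_
  rw [inner_basisVec, basisVec, ← lp.single_smul]
  simp

lemma norm_truncProj_le (n : ℕ) : ‖truncProj n‖ ≤ 1 := by
  refine ContinuousLinearMap.opNorm_le_bound _ zero_le_one fun x => ?_
  rw [one_mul, ← sq_le_sq₀ (norm_nonneg _) (norm_nonneg _), truncProj_apply]
  rw [orthonormal_basisVec.norm_sq_sum]
  exact orthonormal_basisVec.sum_inner_products_le x

lemma adjoint_truncProj (n : ℕ) : ContinuousLinearMap.adjoint (truncProj n) = truncProj n := by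
  simp [truncProj, map_sum]

lemma isCompactOperator_truncProj (n : ℕ) : IsCompactOperator (truncProj n) := by
  have h : truncProj n = ((∑ i ∈ Finset.range n, matrixUnit i i : compactOps) :
      EllTwo →L[ℂ] EllTwo) := by
    simp [truncProj, matrixUnit]
  rw [h]
  exact (∑ i ∈ Finset.range n, matrixUnit i i : compactOps).2

/-- T* is the norm limit of the adjoints T*Pₙ of PₙT, which are compact because Pₙ has finite rank.
-/
lemma IsCompactOperator.adjoint {T : EllTwo →L[ℂ] EllTwo} (hT : IsCompactOperator T) :
    IsCompactOperator (ContinuousLinearMap.adjoint T) := by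
  have h := hT.tendsto_comp norm_truncProj_le tendsto_truncProj
  have h' := (ContinuousLinearMap.adjoint.continuous.tendsto T).comp h
  refine isCompactOperator_of_tendsto h' (Eventually.of_forall fun n => ?_)
  simp only [Function.comp_apply, ContinuousLinearMap.adjoint_comp, adjoint_truncProj]
  exact (isCompactOperator_truncProj n).clm_comp (ContinuousLinearMap.adjoint T)

/-- Truncation on the right is truncation of T* on the left, after taking adjoints. The two are
combined through Pₙ T Pₙ = Pₙ (T Pₙ - T) + Pₙ T with ‖Pₙ‖ ≤ 1. -/
lemma IsCompactOperator.tendsto_truncProj_comp_comp {T : EllTwo →L[ℂ] EllTwo}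
    (hT : IsCompactOperator T) :
    Tendsto (fun n => (truncProj n).comp (T.comp (truncProj n))) atTop (𝓝 T) := by
  have h1 := hT.tendsto_comp norm_truncProj_le tendsto_truncProj
  have h2 := (ContinuousLinearMap.adjoint.continuous.tendsto _).comp
    (hT.adjoint.tendsto_comp norm_truncProj_le tendsto_truncProj)
  simp only [Function.comp_def, ContinuousLinearMap.adjoint_comp, adjoint_truncProj,
    ContinuousLinearMap.adjoint_adjoint] at h2
  have h3 : Tendsto (fun n => (truncProj n).comp (T.comp (truncProj n) - T)) atTop (𝓝 0) := by
    refine squeeze_zero_norm (fun n => ?_) (tendsto_iff_norm_sub_tendsto_zero.1 h2)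
    exact (ContinuousLinearMap.opNorm_comp_le _ _).trans
      (mul_le_of_le_one_left (norm_nonneg _) (norm_truncProj_le n))
  have h4 := h3.add h1
  rw [zero_add] at h4
  refine h4.congr fun n => ?_
  rw [← ContinuousLinearMap.comp_add, sub_add_cancel]

/-- The matrix coefficient `⟪δᵢ, T δⱼ⟫`, as a linear functional of `T`. -/
def coeff (i j : ℕ) : compactOps →ₗ[ℂ] ℂ where
  toFun T := ⟪basisVec i, T.1 (basisVec j)⟫_ℂ
  map_add' S T := by simp
  map_smul' c T := by simp

lemma coeff_apply (i j : ℕ) (T : compactOps) : coeff i j T = ⟪basisVec i, T.1 (basisVec j)⟫_ℂ := rfl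

lemma coeff_matrixUnit (i j k l : ℕ) :
    coeff i j (matrixUnit k l) = if i = k ∧ j = l then 1 else 0 := by
  have h := orthonormal_iff_ite.1 orthonormal_basisVec
  simp only [coeff_apply, matrixUnit, rankOne_apply, inner_smul_right, h]
  split_ifs <;> simp_all

lemma matrixUnit_mul (i j k l : ℕ) :
    matrixUnit i j * matrixUnit k l = if j = k then matrixUnit i l else 0 := by
  have h := orthonormal_iff_ite.1 orthonormal_basisVec j k
  refine Subtype.ext (ContinuousLinearMap.ext fun x => ?_)
  split_ifs with hjk
  · subst hjk
    simp [matrixUnit, h, -inner_self_eq_norm_sq_to_K]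
  · simp [matrixUnit, h, hjk]

/-- The upper left `n × n` corner of a compact operator. -/
def trunc (n : ℕ) (T : compactOps) : compactOps :=
  ∑ i ∈ Finset.range n, ∑ j ∈ Finset.range n, coeff i j T • matrixUnit i j

lemma tendsto_trunc (T : compactOps) : Tendsto (fun n => trunc n T) atTop (𝓝 T) := by
  rw [tendsto_subtype_rng]
  refine (IsCompactOperator.tendsto_truncProj_comp_comp T.2).congr fun n => ?_
  ext1 x
  simp only [trunc, AddSubmonoidClass.coe_finsetSum, sum_apply,
    ContinuousLinearMap.comp_apply, truncProj_apply, map_sum, map_smul]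
  rw [Finset.sum_comm]
  refine Finset.sum_congr rfl fun j _ => ?_
  rw [Finset.smul_sum]
  refine Finset.sum_congr rfl fun i _ => ?_
  simp [matrixUnit, coeff_apply, smul_smul, mul_comm]

-- The matrix is a compression of `T`: ℂⁿ embeds isometrically in ℓ², and reading off n coefficients
-- is contractive by Bessel's inequality. The ℓ² operator norm is the C⋆-norm on matrices, for which
-- `*`-homomorphisms are contractive.
open scoped Matrix.Norms.L2Operator in
lemma norm_coeff_le (n : ℕ) (T : compactOps) :
    ‖(Matrix.of fun i j : Fin n => coeff i j T)‖ ≤ ‖T‖ := by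
  rw [Matrix.l2_opNorm_def]
  refine ContinuousLinearMap.opNorm_le_bound _ (norm_nonneg _) fun x => ?_
  have ho : Orthonormal ℂ fun i : Fin n => basisVec i :=
    orthonormal_basisVec.comp _ Fin.val_injective
  set y : EllTwo := ∑ j : Fin n, x j • basisVec j with hy
  have hxy : ‖y‖ = ‖x‖ := by
    rw [← sq_eq_sq₀ (norm_nonneg _) (norm_nonneg _), EuclideanSpace.norm_sq_eq]
    exact ho.norm_sq_sum x Finset.univ
  have hT : ‖T.1 y‖ ≤ ‖T‖ * ‖x‖ := by
    rw [← hxy]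
    exact T.1.le_opNorm y
  refine le_trans ?_ hT
  rw [← sq_le_sq₀ (norm_nonneg _) (norm_nonneg _), EuclideanSpace.norm_sq_eq]
  refine le_trans (le_of_eq (Finset.sum_congr rfl fun i _ => ?_))
    (ho.sum_inner_products_le (T.1 y) (s := Finset.univ))
  congr 2
  simp [hy, map_sum, inner_sum, inner_smul_right, coeff_apply, Matrix.toLpLin_apply,
    Matrix.mulVec, dotProduct, mul_comm]

end Compact

/-- Elements of `A ⊗̂ 𝒦` are limits of sums of the elements `a ⊗̂ e_{i,j}`. -/
lemma ProjTensor.induction_matrixUnit {A : Type u} [NonUnitalNormedRing A] [NormedSpace ℂ A]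
    [IsScalarTower ℂ A A] [SMulCommClass ℂ A A] {P : ProjTensor A compactOps → Prop}
    (hP : IsClosed {x | P x}) (hadd : ∀ x y, P x → P y → P (x + y))
    (h : ∀ a i j, P (tmul a (matrixUnit i j))) (x : ProjTensor A compactOps) : P x := by
  have h0 : P 0 := by
    have := h 0 0 0
    rwa [zero_tmul] at this
  have hsum : ∀ (s : Finset ℕ) (z : ℕ → ProjTensor A compactOps), (∀ i, P (z i)) →
      P (∑ i ∈ s, z i) := fun s z hz =>
    Finset.sum_induction _ P hadd h0 fun i _ => hz i
  refine ext_closed hP (fun y => ?_) x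
  induction y using AlgTensor.induction_on with
  | h0 => rwa [incl_zero]
  | h2 x y hx hy => rw [incl_add]; exact hadd _ _ hx hy
  | h1 a T =>
    refine hP.mem_of_tendsto (((tmulRight a).continuous.tendsto T).comp (tendsto_trunc T))
      (Filter.Eventually.of_forall fun n => ?_)
    change P (tmulRight a (trunc n T))
    rw [trunc, map_sum]
    refine hsum _ _ fun i => ?_
    rw [map_sum]
    refine hsum _ _ fun j => ?_
    -- The matrix coefficient is absorbed into `a`, so closure of `P` under scalars is not needed.
    rw [map_smul, tmulRight_apply, smul_tmul]
    exact h _ i j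

/-- For a `*`-homomorphism `f : A → B`, a sequence of partial isometries in `B` with orthogonal
ranges and common source projection `f 1`. -/
structure IsFrame {A B : Type*} [CStarAlgebra A] [CStarAlgebra B] (f : A →⋆ₙₐ[ℂ] B)
    (x : ℕ → B) : Prop where
  star_mul : ∀ i j, star (x i) * x j = if i = j then f 1 else 0
  mul_one : ∀ i, x i * f 1 = x i

/-! ### Homomorphisms out of `A ⊗̂ 𝒦` built from frames. -/

section Frame

open Filter Topology

variable {A : Type u} {B : Type v} [CStarAlgebra A] [CStarAlgebra B] {f : A →⋆ₙₐ[ℂ] B}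

/-- The linear map `a ↦ xᵢ f(a) yⱼ*`. -/
def frameUnit (f : A →⋆ₙₐ[ℂ] B) (x y : ℕ → B) (i j : ℕ) : A →ₗ[ℂ] B :=
  (LinearMap.mulRight ℂ (star (y j)) ∘ₗ LinearMap.mulLeft ℂ (x i)) ∘ₗ
    (f.toNonUnitalAlgHom : A →ₗ[ℂ] B)

lemma frameUnit_apply (f : A →⋆ₙₐ[ℂ] B) (x y : ℕ → B) (i j : ℕ) (a : A) :
    frameUnit f x y i j a = x i * f a * star (y j) := rfl

lemma star_frameUnit (f : A →⋆ₙₐ[ℂ] B) (x y : ℕ → B) (i j : ℕ) (a : A) :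
    star (frameUnit f x y i j a) = frameUnit f y x j i (star a) := by
  simp [frameUnit_apply, map_star, mul_assoc]

/-- The inner factor yⱼ* yₖ is 0 or f(1), and f(1) is absorbed by f(a). Only the middle family has
to be a frame. -/
lemma IsFrame.frameUnit_mul {y : ℕ → B} (hy : IsFrame f y) (x z : ℕ → B) (i j k l : ℕ) (a b : A) :
    frameUnit f x y i j a * frameUnit f y z k l b =
      if j = k then frameUnit f x z i l (a * b) else 0 := by
  have h : frameUnit f x y i j a * frameUnit f y z k l b =
      x i * f a * (star (y j) * y k) * f b * star (z l) := by
    simp only [frameUnit_apply, mul_assoc]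
  rw [h, hy.star_mul]
  split_ifs
  · rw [frameUnit_apply, mul_assoc (x i), ← map_mul, _root_.mul_one, mul_assoc (x i), ← map_mul]
  · simp

/-- The homomorphism `a ↦ ∑ₖ xₖ f(a) xₖ*`. -/
def IsFrame.diagHom {x : ℕ → B} (hx : IsFrame f x) (n : ℕ) : A →⋆ₙₐ[ℂ] B where
  toFun a := ∑ k : Fin n, frameUnit f x x k k a
  map_smul' c a := by simp [Finset.smul_sum]
  map_zero' := by simp
  map_add' a b := by simp [Finset.sum_add_distrib]
  map_mul' a b := by
    simp [Finset.sum_mul_sum, hx.frameUnit_mul, Fin.val_inj]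
  map_star' a := by simp [star_sum, star_frameUnit]

/-- The homomorphism `T ↦ ∑ᵢⱼ Tᵢⱼ xᵢ xⱼ*` on matrices. -/
def IsFrame.matrixHom {x : ℕ → B} (hx : IsFrame f x) (n : ℕ) :
    Matrix (Fin n) (Fin n) ℂ →⋆ₙₐ[ℂ] B where
  toFun T := ∑ i : Fin n, ∑ j : Fin n, T i j • frameUnit f x x i j 1
  map_smul' c a := by simp [Finset.smul_sum, smul_smul]
  map_zero' := by simp
  map_add' a b := by simp [Finset.sum_add_distrib, add_smul]
  map_mul' S T := by
    simp only [Matrix.mul_apply, Finset.sum_mul, Finset.sum_smul]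
    refine Finset.sum_congr rfl fun i _ => ?_
    rw [Finset.sum_comm]
    refine Finset.sum_congr rfl fun j _ => ?_
    symm
    rw [Finset.mul_sum, Finset.sum_eq_single j]
    · simp [Finset.mul_sum, hx.frameUnit_mul, smul_smul, mul_comm]
    · intro k _ hk
      simp [Finset.mul_sum, hx.frameUnit_mul, Fin.val_inj, hk.symm]
    · simp
  map_star' T := by
    simp only [star_sum, star_smul, star_frameUnit, star_one, Matrix.star_apply]
    exact Finset.sum_comm

/-- Such a u is a partial isometry: u*u is a self-adjoint idempotent, so the C⋆-identity gives
‖u*u‖² = ‖u*u‖. -/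
lemma norm_le_one_of_mul_star_mul_self {u : B} (h : u * star u * u = u) : ‖u‖ ≤ 1 := by
  have h2 : star u * u * (star u * u) = star u * u := by
    rw [mul_assoc, ← mul_assoc u, h]
  have h3 : ‖star u * u‖ * ‖star u * u‖ = ‖star u * u‖ := by
    rw [← CStarRing.norm_star_mul_self (x := star u * u), star_mul, star_star, h2]
  rw [CStarRing.norm_star_mul_self] at h3
  by_contra! hu
  have : 1 < ‖u‖ * ‖u‖ := by nlinarith
  nlinarith

/-- The sum `∑ᵢⱼ Tᵢⱼ xᵢ f(a) yⱼ*` over `i, j < n`. -/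
def frameSum (f : A →⋆ₙₐ[ℂ] B) (x y : ℕ → B) (n : ℕ) : A →ₗ[ℂ] compactOps →ₗ[ℂ] B :=
  ∑ i ∈ Finset.range n, ∑ j ∈ Finset.range n,
    ((LinearMap.lsmul ℂ B).flip.comp (frameUnit f x y i j)).compl₂ (coeff i j)

lemma frameSum_apply (f : A →⋆ₙₐ[ℂ] B) (x y : ℕ → B) (n : ℕ) (a : A) (T : compactOps) :
    frameSum f x y n a T =
      ∑ i ∈ Finset.range n, ∑ j ∈ Finset.range n, coeff i j T • frameUnit f x y i j a := by
  simp [frameSum, LinearMap.sum_apply]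

lemma frameSum_matrixUnit (f : A →⋆ₙₐ[ℂ] B) (x y : ℕ → B) {n i j : ℕ} (hi : i < n) (hj : j < n)
    (a : A) : frameSum f x y n a (matrixUnit i j) = frameUnit f x y i j a := by
  simp [frameSum_apply, coeff_matrixUnit, ite_and, hi, hj]

-- A termwise estimate would grow with n. Instead the sum factors as (∑ Tᵢⱼ xᵢ f(1) xⱼ*) (∑ xₖ f(a)
-- xₖ*) (∑ xₖ f(1) yₖ*): a `*`-homomorphism applied to a matrix of norm at most ‖T‖, a
-- `*`-homomorphism applied to a, and a partial isometry.
open scoped Matrix.Norms.L2Operator in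
lemma IsFrame.norm_frameSum_le {x y : ℕ → B} (hx : IsFrame f x) (hy : IsFrame f y) (n : ℕ)
    (a : A) (T : compactOps) : ‖frameSum f x y n a T‖ ≤ ‖a‖ * ‖T‖ := by
  let C : Matrix (Fin n) (Fin n) ℂ := Matrix.of fun i j : Fin n => coeff i j T
  let U : B := ∑ k : Fin n, frameUnit f x y k k 1
  have hU : ‖U‖ ≤ 1 := by
    refine norm_le_one_of_mul_star_mul_self ?_
    simp [U, star_sum, star_frameUnit, Finset.sum_mul_sum, hx.frameUnit_mul, hy.frameUnit_mul,
      Fin.val_inj]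
  have h : frameSum f x y n a T = hx.matrixHom n C * (hx.diagHom n a * U) := by
    change _ = (∑ i : Fin n, ∑ j : Fin n, C i j • frameUnit f x x i j 1) *
      ((∑ k : Fin n, frameUnit f x x k k a) * ∑ k : Fin n, frameUnit f x y k k 1)
    have h0 : (∑ k : Fin n, frameUnit f x x k k a) * ∑ k : Fin n, frameUnit f x y k k 1 =
        ∑ k : Fin n, frameUnit f x y k k a := by
      simp [Finset.sum_mul_sum, hx.frameUnit_mul, Fin.val_inj]
    rw [h0]
    simp [frameSum_apply, Finset.sum_range, Finset.sum_mul, Finset.mul_sum, hx.frameUnit_mul,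
      Fin.val_inj, C]
    exact Finset.sum_comm
  have h1 : ‖hx.matrixHom n C‖ ≤ ‖T‖ :=
    (NonUnitalStarAlgHom.norm_apply_le (hx.matrixHom n) C).trans (norm_coeff_le n T)
  have h2 : ‖hx.diagHom n a‖ ≤ ‖a‖ := NonUnitalStarAlgHom.norm_apply_le (hx.diagHom n) a
  rw [h, mul_comm ‖a‖]
  refine (norm_mul_le _ _).trans (mul_le_mul h1 ((norm_mul_le _ _).trans ?_) (norm_nonneg _)
    (norm_nonneg _))
  exact (mul_le_of_le_one_right (norm_nonneg _) hU).trans h2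

lemma frameSum_trunc (f : A →⋆ₙₐ[ℂ] B) (x y : ℕ → B) {m n : ℕ} (h : m ≤ n) (a : A)
    (T : compactOps) : frameSum f x y n a (trunc m T) = frameSum f x y m a T := by
  rw [trunc, map_sum, frameSum_apply]
  refine Finset.sum_congr rfl fun i hi => ?_
  rw [map_sum]
  refine Finset.sum_congr rfl fun j hj => ?_
  rw [map_smul, frameSum_matrixUnit f x y ((Finset.mem_range.1 hi).trans_le h)
    ((Finset.mem_range.1 hj).trans_le h)]

/-- By `frameSum_trunc`, the n-th sum minus the N-th is the n-th sum for `T - trunc N T`, hence at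
most ‖a‖‖T - trunc N T‖. -/
lemma IsFrame.cauchySeq_frameSum {x y : ℕ → B} (hx : IsFrame f x) (hy : IsFrame f y)
    (a : A) (T : compactOps) : CauchySeq fun n => frameSum f x y n a T := by
  have hlim : Tendsto (fun m => ‖a‖ * ‖T - trunc m T‖) atTop (𝓝 0) := by
    have := (tendsto_iff_norm_sub_tendsto_zero.1 (tendsto_trunc T)).const_mul ‖a‖
    rw [mul_zero] at this
    exact this.congr fun m => congrArg (‖a‖ * ·) (norm_sub_rev (trunc m T) T)
  rw [Metric.cauchySeq_iff']
  intro ε hε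
  obtain ⟨N, hN⟩ := (hlim.eventually_lt_const hε).exists
  refine ⟨N, fun n hn => ?_⟩
  rw [dist_eq_norm, ← frameSum_trunc f x y hn, ← map_sub]
  exact (hx.norm_frameSum_le hy n a _).trans_lt hN

/-- The limit `∑ᵢⱼ Tᵢⱼ xᵢ f(a) yⱼ*`. -/
def IsFrame.limit {x y : ℕ → B} (hx : IsFrame f x) (hy : IsFrame f y) (a : A)
    (T : compactOps) : B :=
  (cauchySeq_tendsto_of_complete (hx.cauchySeq_frameSum hy a T)).choose

lemma IsFrame.tendsto_frameSum {x y : ℕ → B} (hx : IsFrame f x) (hy : IsFrame f y) (a : A)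
    (T : compactOps) : Tendsto (fun n => frameSum f x y n a T) atTop (𝓝 (hx.limit hy a T)) :=
  (cauchySeq_tendsto_of_complete (hx.cauchySeq_frameSum hy a T)).choose_spec

/-- The map `(a, T) ↦ ∑ᵢⱼ Tᵢⱼ xᵢ f(a) yⱼ*`, as a bilinear map. -/
def IsFrame.bilin {x y : ℕ → B} (hx : IsFrame f x) (hy : IsFrame f y) :
    A →ₗ[ℂ] compactOps →ₗ[ℂ] B :=
  have h := hx.tendsto_frameSum hy
  LinearMap.mk₂ ℂ (hx.limit hy)
    (fun a b T => tendsto_nhds_unique (h _ _) (((h a T).add (h b T)).congr fun n => by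
      rw [map_add, LinearMap.add_apply]))
    (fun c a T => tendsto_nhds_unique (h _ _) (((h a T).const_smul c).congr fun n => by
      rw [map_smul, LinearMap.smul_apply]))
    (fun a S T => tendsto_nhds_unique (h _ _) (((h a S).add (h a T)).congr fun n => by
      rw [map_add]))
    (fun c a T => tendsto_nhds_unique (h _ _) (((h a T).const_smul c).congr fun n => by
      rw [map_smul]))

lemma IsFrame.norm_limit_le {x y : ℕ → B} (hx : IsFrame f x) (hy : IsFrame f y) (a : A)
    (T : compactOps) : ‖hx.limit hy a T‖ ≤ ‖a‖ * ‖T‖ :=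
  le_of_tendsto (hx.tendsto_frameSum hy a T).norm
    (Eventually.of_forall fun n => hx.norm_frameSum_le hy n a T)

lemma IsFrame.bilin_matrixUnit {x y : ℕ → B} (hx : IsFrame f x) (hy : IsFrame f y) (a : A)
    (i j : ℕ) : hx.bilin hy a (matrixUnit i j) = frameUnit f x y i j a := by
  refine tendsto_nhds_unique (hx.tendsto_frameSum hy a (matrixUnit i j))
    (tendsto_const_nhds.congr' ?_)
  filter_upwards [eventually_gt_atTop i, eventually_gt_atTop j] with n hi hj
  exact (frameSum_matrixUnit f x y hi hj a).symm

/-- The map `A ⊗̂ 𝒦 → B`, `a ⊗̂ e_{i,j} ↦ xᵢ f(a) yⱼ*`. -/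
def IsFrame.lift {x y : ℕ → B} (hx : IsFrame f x) (hy : IsFrame f y) :
    ProjTensor A compactOps →L[ℂ] B :=
  ProjTensor.lift (hx.bilin hy) (hx.norm_limit_le hy)

lemma IsFrame.lift_tmul_matrixUnit {x y : ℕ → B} (hx : IsFrame f x) (hy : IsFrame f y) (a : A)
    (i j : ℕ) : hx.lift hy (ProjTensor.tmul a (matrixUnit i j)) = x i * f a * star (y j) :=
  (ProjTensor.lift_tmul _ _ _ _).trans (hx.bilin_matrixUnit hy a i j)

/-- By density this reduces to `frameUnit_mul`. With equal frames it gives multiplicativity of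
`IsFrame.hom`; with three frames it is the hypothesis of `IsM2Stable.map_eq_of_entrywise`. -/
lemma IsFrame.lift_mul_lift {x y z : ℕ → B} (hx : IsFrame f x) (hy : IsFrame f y)
    (hz : IsFrame f z) (s t : ProjTensor A compactOps) :
    hx.lift hy s * hy.lift hz t = hx.lift hz (s * t) := by
  induction s using ProjTensor.induction_matrixUnit with
  | hP =>
    exact isClosed_eq (f := fun s => hx.lift hy s * hy.lift hz t)
      ((hx.lift hy).continuous.mul continuous_const)
      ((hx.lift hz).continuous.comp (continuous_id.mul continuous_const))
  | hadd s s' h h' => rw [map_add, add_mul, h, h', add_mul, map_add]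
  | h a i j =>
    induction t using ProjTensor.induction_matrixUnit with
    | hP =>
      exact isClosed_eq (f := fun t => hx.lift hy (ProjTensor.tmul a (matrixUnit i j)) *
          hy.lift hz t) (continuous_const.mul (hy.lift hz).continuous)
        ((hx.lift hz).continuous.comp (continuous_const.mul continuous_id))
    | hadd s s' h h' => rw [map_add, mul_add, h, h', mul_add, map_add]
    | h b k l =>
      rw [ProjTensor.tmul_mul_tmul, matrixUnit_mul, hx.lift_tmul_matrixUnit,
        hy.lift_tmul_matrixUnit]
      refine (hy.frameUnit_mul x z i j k l a b).trans ?_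
      split_ifs
      · rw [hx.lift_tmul_matrixUnit, frameUnit_apply]
      · exact ((congrArg (hx.lift hz) (ProjTensor.tmul_zero (a * b))).trans (map_zero _)).symm

/-- The homomorphism `A ⊗̂ 𝒦 → B`, `a ⊗̂ e_{i,j} ↦ xᵢ f(a) xⱼ*`. -/
def IsFrame.hom {x : ℕ → B} (hx : IsFrame f x) : ProjTensor A compactOps →ₙₐ[ℂ] B where
  toFun := hx.lift hx
  map_smul' c t := map_smul (hx.lift hx) c t
  map_zero' := map_zero (hx.lift hx)
  map_add' := map_add (hx.lift hx)
  map_mul' s t := (hx.lift_mul_lift hx hx s t).symm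

end Frame

/-! ### The retraction, its independence of the frame, and naturality. -/

namespace ProperlyInfinite

variable {O O' : Type u} [CStarAlgebra O] [CStarAlgebra O']

/-- The homomorphism `O ⊗̂ 𝒦 → O'` determined by a frame. -/
def frameMap {f : O →⋆ₙₐ[ℂ] O'} {x : ℕ → O'} (hx : IsFrame f x) : stab O ⟶ obj O' where
  toAlgHom := hx.hom
  continuous_toAlgHom := (hx.lift hx).continuous

lemma frameMap_tmul {f : O →⋆ₙₐ[ℂ] O'} {x : ℕ → O'} (hx : IsFrame f x) (a : O) (i j : ℕ) :
    (frameMap hx).toAlgHom (ProjTensor.tmul a (matrixUnit i j)) = x i * f a * star (x j) :=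
  hx.lift_tmul_matrixUnit hx a i j

lemma hom_ext_matrixUnit {L : LCAlg.{u}} {φ ψ : stab O ⟶ L}
    (h : ∀ a i j, φ.toAlgHom (ProjTensor.tmul a (matrixUnit i j)) =
      ψ.toAlgHom (ProjTensor.tmul a (matrixUnit i j))) : φ = ψ := by
  refine LCAlg.hom_ext fun t => ?_
  induction t using ProjTensor.induction_matrixUnit with
  | hP => exact isClosed_eq φ.continuous_toAlgHom ψ.continuous_toAlgHom
  | hadd s t hs ht => rw [map_add, map_add, hs, ht]
  | h a i j => exact h a i j

/-- The family is xᵢ = sⁱ t. For i < j, xᵢ* xⱼ = t* sʲ⁻ⁱ t contains the factor t* s = 0; the case j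
< i follows by taking adjoints. -/
lemma exists_isFrame (hO : IsProperlyInfinite O) :
    ∃ x : ℕ → O, IsFrame (NonUnitalStarAlgHom.id ℂ O) x := by
  obtain ⟨s, t, hs, ht, hst⟩ := hO
  have hpow : ∀ n, star (s ^ n) * s ^ n = 1 := fun n => by
    induction n with
    | zero => simp
    | succ n ih =>
      rw [pow_succ', star_mul, mul_assoc, ← mul_assoc (star s), hs, one_mul, ih]
  have hlt : ∀ i j, i < j → star (s ^ i * t) * (s ^ j * t) = 0 := fun i j hij => by
    obtain ⟨k, rfl⟩ := Nat.exists_eq_add_of_lt hij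
    have hts : star t * s = 0 := by simpa using congrArg star hst
    rw [add_assoc, pow_add, pow_succ', star_mul, mul_assoc, ← mul_assoc (star (s ^ i)),
      ← mul_assoc (star (s ^ i)), hpow, one_mul, ← mul_assoc, ← mul_assoc, hts, zero_mul, zero_mul]
  refine ⟨fun i => s ^ i * t, fun i j => ?_, fun i => mul_one _⟩
  rcases lt_trichotomy i j with h | rfl | h
  · rw [if_neg h.ne, hlt i j h]
  · rw [if_pos rfl, star_mul, mul_assoc, ← mul_assoc (star (s ^ i)), hpow, one_mul, ht]
    rfl
  · rw [if_neg h.ne']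
    simpa using congrArg star (hlt j i h)

variable {E : LCAlg.{u} ⥤ AddCommGrpCat.{w}}

lemma map_frameMap_eq (hE : LCAlg.IsM2Stable E) {f : O →⋆ₙₐ[ℂ] O'} {x y : ℕ → O'}
    (hx : IsFrame f x) (hy : IsFrame f y) : E.map (frameMap hx) = E.map (frameMap hy) := by
  let z : Fin 2 → ℕ → O' := ![x, y]
  have hz : ∀ p, IsFrame f (z p) := fun p => by fin_cases p <;> assumption
  exact hE.map_eq_of_entrywise (fun p => frameMap (hz p)) (fun p q => (hz p).lift (hz q))
    (fun p q r s t => (hz p).lift_mul_lift (hz q) (hz r) s t) fun _ _ => rfl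

lemma map_eq_id_of_isometry (hE : LCAlg.IsM2Stable E) {v : O} (hv : star v * v = 1)
    (φ : obj O ⟶ obj O) (hφ : ∀ a : O, φ.toAlgHom a = v * a * star v) : E.map φ = 𝟙 _ := by
  -- The entrywise maps are a ↦ z_p a z_q*. They multiply correctly because each z_q is an isometry;
  -- v and 1 need not have orthogonal ranges.
  let z : Fin 2 → O := ![v, 1]
  have hz : ∀ p, star (z p) * z p = 1 := fun p => by fin_cases p <;> simp [z, hv]
  let g : Fin 2 → Fin 2 → O →L[ℂ] O := fun p q =>
    ContinuousLinearMap.mulLeftRight ℂ O (z p) (star (z q))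
  have hg : ∀ p q a, g p q a = z p * a * star (z q) := fun p q a => by simp [g]
  let ψ : Fin 2 → (obj O ⟶ obj O) := ![φ, 𝟙 _]
  have h := hE.map_eq_of_entrywise ψ g (fun p q r a b => by
    simp only [hg]
    rw [mul_assoc, ← mul_assoc (star (z q)), ← mul_assoc (star (z q)), hz, one_mul]
    simp only [mul_assoc]) (fun p a => by
    rw [hg]
    fin_cases p
    · exact hφ a
    · exact (by simp [z] : a = z 1 * a * star (z 1)))
  simpa [ψ] using h

lemma map_inclK_comp_map_frameMap (hE : LCAlg.IsM2Stable E) {x : ℕ → O}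
    (hx : IsFrame (NonUnitalStarAlgHom.id ℂ O) x) :
    E.map (inclK O) ≫ E.map (frameMap hx) = 𝟙 _ := by
  rw [← E.map_comp]
  exact map_eq_id_of_isometry hE (v := x 0) (by simpa using hx.star_mul 0 0) _
    fun a => frameMap_tmul hx a 0 0

lemma map_stabMap_comp_map_frameMap (hE : LCAlg.IsM2Stable E) (f : O →⋆ₙₐ[ℂ] O') {x : ℕ → O}
    {y : ℕ → O'} (hx : IsFrame (NonUnitalStarAlgHom.id ℂ O) x)
    (hy : IsFrame (NonUnitalStarAlgHom.id ℂ O') y) :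
    E.map (stabMap f) ≫ E.map (frameMap hy) = E.map (frameMap hx) ≫ E.map (objMap f) := by
  have hf : f 1 * f 1 = f 1 := by rw [← map_mul, one_mul]
  have hf' : star (f 1) = f 1 := by rw [← map_star, star_one]
  have hfx : IsFrame f fun i => f (x i) := by
    refine ⟨fun i j => ?_, fun i => by rw [← map_mul, mul_one]⟩
    rw [← map_star, ← map_mul, hx.star_mul]
    split_ifs <;> simp
  -- The isometries yᵢ are cut down to have source f(1), as a frame for f requires. This does not
  -- change yᵢ f(a) yⱼ*, since f(1) f(a) f(1) = f(a).
  have hfy : IsFrame f fun i => y i * f 1 := by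
    refine ⟨fun i j => ?_, fun i => by rw [mul_assoc, hf]⟩
    rw [star_mul, hf', mul_assoc, ← mul_assoc (star (y i)), hy.star_mul]
    split_ifs <;> simp [hf]
  have h1 : stabMap f ≫ frameMap hy = frameMap hfy := by
    refine hom_ext_matrixUnit fun a i j => ?_
    rw [frameMap_tmul, LCAlg.comp_apply]
    refine (congrArg _ (ProjTensor.map_tmul _ _ (objMap f).continuous_toAlgHom continuous_id a _)).trans
      ((frameMap_tmul hy (f a) i j).trans ?_)
    have ha : f 1 * f a * f 1 = f a := by rw [← map_mul, ← map_mul, one_mul, mul_one]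
    calc y i * f a * star (y j) = y i * (f 1 * f a * f 1) * star (y j) := by rw [ha]
      _ = _ := by rw [star_mul, hf']; simp only [mul_assoc]
  have h2 : frameMap hx ≫ objMap f = frameMap hfx := by
    refine hom_ext_matrixUnit fun a i j => ?_
    rw [frameMap_tmul, LCAlg.comp_apply, frameMap_tmul]
    change f _ = _
    rw [map_mul, map_mul, map_star]
    rfl
  rw [← E.map_comp, ← E.map_comp, h1, h2, map_frameMap_eq hE hfy hfx]

end ProperlyInfinite

end

/-- For every `M₂`-stable functor `E` on locally convex algebras and every properly infinite
C⋆-algebra `O`, the map `E(k) : E(O) → E(O ⊗̂ 𝒦)` has a left inverse, and these left inverses `r`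
can be chosen naturally in `O` (for `*`-homomorphisms) and in `E` (for natural transformations). -/
theorem corollary2p5 :
    ∃ r : ∀ (E : LCAlg.{u} ⥤ AddCommGrpCat.{w}) (_ : LCAlg.IsM2Stable E)
        (O : Type u) [CStarAlgebra O] (_ : IsProperlyInfinite O),
        E.obj (ProperlyInfinite.stab O) ⟶ E.obj (ProperlyInfinite.obj O),
      (∀ (E : LCAlg.{u} ⥤ AddCommGrpCat.{w}) (hE : LCAlg.IsM2Stable E)
        (O : Type u) [CStarAlgebra O] (hO : IsProperlyInfinite O),
        E.map (ProperlyInfinite.inclK O) ≫ r E hE O hO = 𝟙 (E.obj (ProperlyInfinite.obj O))) ∧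
      (∀ (E : LCAlg.{u} ⥤ AddCommGrpCat.{w}) (hE : LCAlg.IsM2Stable E)
        (O O' : Type u) [CStarAlgebra O] [CStarAlgebra O']
        (hO : IsProperlyInfinite O) (hO' : IsProperlyInfinite O') (f : O →⋆ₙₐ[ℂ] O'),
        E.map (ProperlyInfinite.stabMap f) ≫ r E hE O' hO' =
          r E hE O hO ≫ E.map (ProperlyInfinite.objMap f)) ∧
      (∀ (E E' : LCAlg.{u} ⥤ AddCommGrpCat.{w}) (hE : LCAlg.IsM2Stable E)
        (hE' : LCAlg.IsM2Stable E') (τ : E ⟶ E')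
        (O : Type u) [CStarAlgebra O] (hO : IsProperlyInfinite O),
        τ.app (ProperlyInfinite.stab O) ≫ r E' hE' O hO =
          r E hE O hO ≫ τ.app (ProperlyInfinite.obj O)) := by
  -- The chosen frame depends on `O` but not on `E`, so naturality in `E` is that of τ at a single
  -- morphism. The arbitrary choice does not harm naturality in `O`, by `map_frameMap_eq`.
  refine ⟨fun E _ O _ hO =>
    E.map (ProperlyInfinite.frameMap (ProperlyInfinite.exists_isFrame hO).choose_spec),
    fun E hE O _ hO => ProperlyInfinite.map_inclK_comp_map_frameMap hE _,
    fun E hE O O' _ _ hO hO' f => ProperlyInfinite.map_stabMap_comp_map_frameMap hE f _ _,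
    fun E E' _ _ τ O _ hO => (τ.naturality _).symm⟩
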